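/- Let $\mathbb D=\{z\in\mathbb C:|z|<1\}$ and let $\mathcal K$ be the class of convex univalent functions, i.e. of analytic functions $f$ in $\mathbb D$ with $f(0)=0$, $f'(0)=1$, such that $f'(z)\neq 0$ and $\mathrm{Re}\{1+zf''(z)/f'(z)\}>0$ for all $z\in\mathbb D$. For $q\in[0,1)$ let $\mathrm d_qf$ be Jackson's $q$-derivative, $\mathrm d_qf(z)=\frac{f(qz)-f(z)}{(q-1)z}$ for $z\neq0$ and $\mathrm d_qf(0)=f'(0)$. If $f\in\mathcal K$, then for all $q\in[0,1)$ and all $z$ with $|z|=r<1$ we have $\mathrm d_qf(z)\neq0$, $$\frac{1+qr}{1+r}\le \mathrm{Re}\left\{\frac{f'(z)}{\mathrm d_qf(z)}\right\}\le\frac{1-qr}{1-r} \qquad\text{and}\qquad \frac{1+qr}{1+r}\le \left|\frac{f'(z)}{\mathrm d_qf(z)}\right|\le\frac{1-qr}{1-r}.$$ The bounds are sharp: the function $h(z)=z/(1-z)$ belongs to $\mathcal K$ and, for all $q\in[0,1)$ and $r\in[0,1)$, it gives equality in both lower bounds at $z=-r$ and in both upper bounds at $z=r$. -/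

import Mathlib

/-- The class `𝒜`: functions analytic in the open unit disc (complex differentiable on an
open set), normalized by `f 0 = 0` and `f' 0 = 1`. Values outside the disc are irrelevant. -/
def NormalizedAnalytic : Set (ℂ → ℂ) :=
  {f | DifferentiableOn ℂ f (Metric.ball 0 1) ∧ f 0 = 0 ∧ deriv f 0 = 1}

/-- The class `𝒦` of convex univalent functions: those `f ∈ 𝒜` for which the quotient
`z f''(z) / f'(z)` is defined (i.e. `f'(z) ≠ 0`) and `Re (1 + z f''(z) / f'(z)) > 0`
throughout the open unit disc. -/
def ConvexUnivalent : Set (ℂ → ℂ) :=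
  {f | f ∈ NormalizedAnalytic ∧ ∀ z ∈ Metric.ball (0 : ℂ) 1,
    deriv f z ≠ 0 ∧ 0 < (1 + z * deriv (deriv f) z / deriv f z).re}

open Classical in
/-- Jackson's `q`-derivative: `d_q f(z) = (f(qz) - f(z)) / ((q - 1) z)` for `z ≠ 0`, and
`d_q f(0) = f'(0)`. -/
noncomputable def jacksonDeriv (q : ℝ) (f : ℂ → ℂ) (z : ℂ) : ℂ :=
  if z = 0 then deriv f 0 else (f ((q : ℂ) * z) - f z) / (((q : ℂ) - 1) * z)

open Metric Set

/-! Convexity puts the image of the circle `|w| = |z|` on one side of its tangent at `f z`. By the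
maximum principle this yields `Re (2zf'(z)/(f z - f w)) ≥ Re ((z+w)/(z-w))` for `|w| ≤ |z|`, `w ≠ z`
(`ConvexUnivalent.half_plane`). At `w = qz` it says that `g = f'/d_q f` satisfies `Re g ≥ (1+q)/2`,
i.e. `g` is at least as close to `1` as to `q`. Since `g 0 = 1`, the Schwarz lemma for `(g-1)/(g-q)`
gives `|g-1| ≤ r|g-q|`: an Apollonius disc whose diameter is the real interval between the two
stated bounds. -/

/-! ### Tangents to the images of circles -/

theorem exists_log_on_ball {g : ℂ → ℂ} (hg : DifferentiableOn ℂ g (ball 0 1))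
    (hg0 : ∀ w ∈ ball (0 : ℂ) 1, g w ≠ 0) :
    ∃ L : ℂ → ℂ, (∀ w ∈ ball (0 : ℂ) 1, HasDerivAt L (deriv g w / g w) w) ∧
      ∀ w ∈ ball (0 : ℂ) 1, ∀ z ∈ ball (0 : ℂ) 1, g w = g z * Complex.exp (L w - L z) := by
  obtain ⟨L, hL⟩ := ((hg.deriv isOpen_ball).div hg hg0).isExactOn_ball
  refine ⟨L, hL, fun w hw z hz => ?_⟩
  have key : ∀ x ∈ ball (0 : ℂ) 1, HasDerivAt (fun x => g x * Complex.exp (-L x)) 0 x := by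
    intro x hx
    have h1 := (hg.differentiableAt (isOpen_ball.mem_nhds hx)).hasDerivAt
    refine (h1.mul (hL x hx).neg.cexp).congr_deriv ?_
    have := hg0 x hx
    simp only [Pi.div_apply, Pi.neg_apply]
    field_simp
    ring
  have h := isOpen_ball.is_const_of_deriv_eq_zero (convex_ball (0 : ℂ) 1).isPreconnected
    (fun x hx => (key x hx).differentiableAt.differentiableWithinAt)
    (fun x hx => (key x hx).deriv) hw hz
  simp only [Complex.exp_neg] at h
  rw [Complex.exp_sub]
  have := Complex.exp_ne_zero (L w)
  field_simp at h ⊢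
  linear_combination h

theorem mul_exp_mem_ball {z : ℂ} (hz : z ∈ ball (0 : ℂ) 1) (θ : ℝ) :
    z * Complex.exp (θ * Complex.I) ∈ ball (0 : ℂ) 1 := by
  simpa [Complex.norm_exp_ofReal_mul_I] using hz

theorem ConvexUnivalent.re_chord_pos {f : ℂ → ℂ} (hf : f ∈ ConvexUnivalent) {z : ℂ}
    (hz : z ∈ ball (0 : ℂ) 1) (hz0 : z ≠ 0) {θ : ℝ} (hθ : θ ∈ Ioo 0 (2 * Real.pi)) :
    0 < ((f z - f (z * Complex.exp (θ * Complex.I))) / (z * deriv f z)).re := by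
  obtain ⟨⟨hd, -, -⟩, hc⟩ := hf
  obtain ⟨L, hL, hfL⟩ := exists_log_on_ball (hd.deriv isOpen_ball) (fun w hw => (hc w hw).1)
  set c : ℝ → ℂ := fun t => z * Complex.exp (t * Complex.I) with hc_def
  have hcb : ∀ t, c t ∈ ball (0 : ℂ) 1 := mul_exp_mem_ball hz
  have hc' : ∀ t, HasDerivAt c (c t * Complex.I) t := by
    intro t
    have h := ((Complex.ofRealCLM.hasDerivAt (x := t)).mul_const Complex.I).cexp.const_mul z
    refine h.congr_deriv ?_
    simp [hc_def]; ring
  have hfz := (hc z hz).1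
  -- `φ` is the tangent angle of the image curve, normalized to vanish at `t = 0`. Its derivative is
  -- the positive convexity functional, and it gains `2π` over one turn.
  set φ : ℝ → ℝ := fun t => t + (L (c t) - L z).im with hφ_def
  have hφ' : ∀ t, HasDerivAt φ ((1 + c t * deriv (deriv f) (c t) / deriv f (c t)).re) t := by
    intro t
    have h1 := ((hL _ (hcb t)).comp t (hc' t)).sub_const (L z)
    have h2 := Complex.imCLM.hasFDerivAt.comp_hasDerivAt t h1
    refine ((hasDerivAt_id t).add h2).congr_deriv ?_
    simp [div_eq_mul_inv]
    ring
  have hφmono : StrictMono φ :=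
    strictMono_of_deriv_pos fun t => by rw [(hφ' t).deriv]; exact (hc _ (hcb t)).2
  have hφc : Continuous φ := continuous_iff_continuousAt.2 fun t => (hφ' t).continuousAt
  have hc0 : c 0 = z := by simp [hc_def]
  have hc2 : c (2 * Real.pi) = z := by simp [hc_def, Complex.exp_two_pi_mul_I]
  have hφ0 : φ 0 = 0 := by simp [hφ_def, hc0]
  have hφ2 : φ (2 * Real.pi) = 2 * Real.pi := by simp [hφ_def, hc2]
  set u : ℝ → ℝ := fun t => ((f z - f (c t)) / (z * deriv f z)).re with hu_def
  have hu' : ∀ t, HasDerivAt u (Real.exp (L (c t) - L z).re * Real.sin (φ t)) t := by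
    intro t
    have h0 := (hd.differentiableAt (isOpen_ball.mem_nhds (hcb t))).hasDerivAt
    have h1 := ((h0.comp t (hc' t)).const_sub (f z)).div_const (z * deriv f z)
    have h2 := Complex.reCLM.hasFDerivAt.comp_hasDerivAt t h1
    refine h2.congr_deriv ?_
    rw [hfL _ (hcb t) z hz]
    have : -(deriv f z * Complex.exp (L (c t) - L z) * (c t * Complex.I)) / (z * deriv f z)
        = -Complex.I * Complex.exp ((L (c t) - L z) + t * Complex.I) := by
      rw [Complex.exp_add, hc_def]; field_simp
    rw [this]
    simp [Complex.exp_im, hφ_def, add_comm]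
  have hu_c : Continuous u := continuous_iff_continuousAt.2 fun t => (hu' t).continuousAt
  have hu0 : u 0 = 0 := by simp [hu_def, hc0]
  have hu2 : u (2 * Real.pi) = 0 := by simp [hu_def, hc2]
  have hpi := Real.pi_pos
  -- `u'` has the sign of `sin φ`, so `u` rises up to `τ` and then falls. As it vanishes at both
  -- ends, it is positive in between.
  obtain ⟨τ, hτ, hφτ⟩ : Real.pi ∈ φ '' Icc 0 (2 * Real.pi) :=
    intermediate_value_Icc (by positivity) hφc.continuousOn
      ⟨by rw [hφ0]; exact hpi.le, by rw [hφ2]; linarith⟩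
  change 0 < u θ
  rcases le_total θ τ with h | h
  · have hm : StrictMonoOn u (Icc 0 τ) := by
      refine strictMonoOn_of_deriv_pos (convex_Icc _ _) hu_c.continuousOn fun t ht => ?_
      rw [interior_Icc] at ht
      rw [(hu' t).deriv]
      refine mul_pos (Real.exp_pos _) (Real.sin_pos_of_pos_of_lt_pi ?_ ?_)
      · rw [← hφ0]; exact hφmono ht.1
      · rw [← hφτ]; exact hφmono ht.2
    rw [← hu0]
    exact hm ⟨le_rfl, hτ.1⟩ ⟨hθ.1.le, h⟩ hθ.1
  · have hm : StrictAntiOn u (Icc τ (2 * Real.pi)) := by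
      refine strictAntiOn_of_deriv_neg (convex_Icc _ _) hu_c.continuousOn fun t ht => ?_
      rw [interior_Icc] at ht
      rw [(hu' t).deriv]
      refine mul_neg_of_pos_of_neg (Real.exp_pos _) ?_
      have h1 : Real.pi < φ t := by rw [← hφτ]; exact hφmono ht.1
      have h2 : φ t < 2 * Real.pi := by
        have := hφmono ht.2
        rwa [hφ2] at this
      have := Real.sin_pos_of_pos_of_lt_pi (x := φ t - Real.pi) (by linarith) (by linarith)
      rw [Real.sin_sub_pi] at this
      linarith
    rw [← hu2]
    exact hm ⟨h, hθ.2.le⟩ ⟨hτ.2, le_rfl⟩ hθ.2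

theorem exists_mul_exp_eq {z w : ℂ} (hz0 : z ≠ 0) (hw : ‖w‖ = ‖z‖) (hne : w ≠ z) :
    ∃ θ ∈ Ioo 0 (2 * Real.pi), z * Complex.exp (θ * Complex.I) = w := by
  have h1 : ‖w / z‖ = 1 := by rw [norm_div, hw, div_self (norm_ne_zero_iff.2 hz0)]
  have h2 : Complex.exp ((w / z).arg * Complex.I) = w / z := by
    have := Complex.norm_mul_exp_arg_mul_I (w / z)
    rwa [h1, Complex.ofReal_one, one_mul] at this
  have hpi := Real.pi_pos
  have ha : (w / z).arg ≠ 0 := by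
    intro h
    rw [h] at h2
    simp only [Complex.ofReal_zero, zero_mul, Complex.exp_zero] at h2
    exact hne ((div_eq_one_iff_eq hz0).1 h2.symm)
  have hl := Complex.neg_pi_lt_arg (w / z)
  have hr := Complex.arg_le_pi (w / z)
  rcases lt_or_gt_of_ne ha with h | h
  · refine ⟨(w / z).arg + 2 * Real.pi, ⟨by linarith, by linarith⟩, ?_⟩
    push_cast
    rw [add_mul, Complex.exp_add, Complex.exp_two_pi_mul_I, h2]
    field_simp
  · refine ⟨(w / z).arg, ⟨h, by linarith⟩, ?_⟩
    rw [h2]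
    field_simp

/-! ### From the circle to the disc -/

/-- Maximum modulus principle for `exp (-v)`, whose norm is `exp (-Re v)`. -/
theorem re_nonneg_of_re_nonneg_sphere {v : ℂ → ℂ} {ρ : ℝ} (hρ : ρ ≠ 0)
    (hv : DifferentiableOn ℂ v (closedBall 0 ρ)) (hs : ∀ w ∈ sphere (0 : ℂ) ρ, 0 ≤ (v w).re)
    {w : ℂ} (hw : w ∈ closedBall (0 : ℂ) ρ) : 0 ≤ (v w).re := by
  have hd : DiffContOnCl ℂ (fun w => Complex.exp (-v w)) (ball 0 ρ) := by
    refine DifferentiableOn.diffContOnCl ?_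
    rw [closure_ball _ hρ]
    exact hv.neg.cexp
  have := Complex.norm_le_of_forall_mem_frontier_norm_le (C := 1) isBounded_ball hd
    (fun x hx => ?_) (z := w) (by rwa [closure_ball _ hρ])
  · simpa [Complex.norm_exp] using this
  · rw [frontier_ball _ hρ] at hx
    simpa [Complex.norm_exp] using hs x hx

theorem ConvexUnivalent.apply_ne {f : ℂ → ℂ} (hf : f ∈ ConvexUnivalent) {z w : ℂ}
    (hz : z ∈ ball (0 : ℂ) 1) (hz0 : z ≠ 0) (hw : ‖w‖ ≤ ‖z‖) (hne : w ≠ z) : f w ≠ f z := by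
  set v : ℂ → ℂ := fun w => (f z - f w) / (z * deriv f z) with hv
  have hsub : closedBall (0 : ℂ) ‖z‖ ⊆ ball 0 1 := closedBall_subset_ball (by simpa using hz)
  have hρ : ‖z‖ ≠ 0 := norm_ne_zero_iff.2 hz0
  have hvd : DifferentiableOn ℂ v (closedBall 0 ‖z‖) :=
    ((hf.1.1.mono hsub).const_sub (f z)).div_const _
  have hpos : ∀ x, ‖x‖ = ‖z‖ → x ≠ z → 0 < (v x).re := by
    intro x hx hxz
    obtain ⟨θ, hθ, rfl⟩ := exists_mul_exp_eq hz0 hx hxz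
    exact ConvexUnivalent.re_chord_pos hf hz hz0 hθ
  have hnn : ∀ x ∈ closedBall (0 : ℂ) ‖z‖, 0 ≤ (v x).re := by
    refine fun x hx => re_nonneg_of_re_nonneg_sphere hρ hvd (fun y hy => ?_) hx
    rcases eq_or_ne y z with rfl | h
    · simp [hv]
    · exact (hpos y (by simpa using hy) h).le
  intro heq
  have hvw : v w = 0 := by simp [hv, heq]
  rcases hw.lt_or_eq with h | h
  · have hd : DiffContOnCl ℂ (fun w => Complex.exp (-v w)) (ball 0 ‖z‖) := by
      refine DifferentiableOn.diffContOnCl ?_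
      rw [closure_ball _ hρ]
      exact hvd.neg.cexp
    -- An interior zero of `v` would make `|exp (-v)|` constant, forcing `Re v = 0` at the boundary
    -- point `-z`, where it is positive.
    have := Complex.norm_eqOn_closure_of_isPreconnected_of_isMaxOn
      (convex_ball (0 : ℂ) ‖z‖).isPreconnected isOpen_ball hd (c := w) (by simpa using h)
      (fun x hx => by simpa [Complex.norm_exp, hvw] using hnn x (ball_subset_closedBall hx))
      (x := -z) (by rw [closure_ball _ hρ]; simp)
    have h2 := hpos (-z) (by simp) (by simpa [neg_eq_self] using hz0)
    simp [Complex.norm_exp, hvw] at this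
    exact h2.ne' this
  · have := hpos w h hne
    simp [hvw] at this

/-- The difference of the two quotients has a removable singularity at `w = z`. On the circle
`(z+w)/(z-w)` is purely imaginary, and the other term has positive real part by `re_chord_pos`. -/
theorem ConvexUnivalent.half_plane {f : ℂ → ℂ} (hf : f ∈ ConvexUnivalent) {z w : ℂ}
    (hz : z ∈ ball (0 : ℂ) 1) (hz0 : z ≠ 0) (hw : ‖w‖ ≤ ‖z‖) (hne : w ≠ z) :
    ((z + w) / (z - w)).re ≤ (2 * z * deriv f z / (f z - f w)).re := by
  have hsub : closedBall (0 : ℂ) ‖z‖ ⊆ ball 0 1 := closedBall_subset_ball (by simpa using hz)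
  have hρ : ‖z‖ ≠ 0 := norm_ne_zero_iff.2 hz0
  have hfz := (hf.2 z hz).1
  set D : ℂ → ℂ := dslope f z with hD
  have hDd : DifferentiableOn ℂ D (ball 0 1) :=
    (Complex.differentiableOn_dslope (isOpen_ball.mem_nhds hz)).2 hf.1.1
  have hD0 : ∀ x ∈ closedBall (0 : ℂ) ‖z‖, D x ≠ 0 := by
    intro x hx
    rcases eq_or_ne x z with rfl | h
    · simpa [hD] using hfz
    · rw [hD, dslope_of_ne _ h, slope_def_field]
      exact div_ne_zero (sub_ne_zero.2 (ConvexUnivalent.apply_ne hf hz hz0 (by simpa using hx) h))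
        (sub_ne_zero.2 h)
  set s : Set ℂ := ball 0 1 ∩ D ⁻¹' {0}ᶜ with hs
  have hso : IsOpen s := hDd.continuousOn.isOpen_inter_preimage isOpen_ball isOpen_compl_singleton
  have hcs : closedBall (0 : ℂ) ‖z‖ ⊆ s := fun x hx => ⟨hsub hx, hD0 x hx⟩
  have hzs : z ∈ s := hcs (by simp)
  -- The difference multiplied by `x - z`, so that `dslope N z` is its holomorphic extension across
  -- `z`.
  set N : ℂ → ℂ := fun x => (z + x) - 2 * z * deriv f z / D x with hN
  have hNd : DifferentiableOn ℂ N s := by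
    refine (differentiableOn_id.const_add z).sub ?_
    exact (differentiableOn_const _).div (hDd.mono inter_subset_left) fun x hx => hx.2
  have hNz : N z = 0 := by
    simp only [hN, hD, dslope_same]
    field_simp
    ring
  set k : ℂ → ℂ := dslope N z with hk
  have hkd : DifferentiableOn ℂ k s :=
    (Complex.differentiableOn_dslope (hso.mem_nhds hzs)).2 hNd
  have hke : ∀ x ∈ closedBall (0 : ℂ) ‖z‖, x ≠ z →
      k x = 2 * z * deriv f z / (f z - f x) - (z + x) / (z - x) := by
    intro x hx h
    have h1 := sub_ne_zero.2 (ConvexUnivalent.apply_ne hf hz hz0 (by simpa using hx) h)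
    have h2 := sub_ne_zero.2 h
    have h3 : f z - f x ≠ 0 := by rwa [← neg_ne_zero, neg_sub]
    have h4 : z - x ≠ 0 := by rwa [← neg_ne_zero, neg_sub]
    rw [hk, dslope_of_ne _ h, slope_def_field, hNz]
    simp only [hN, hD]
    rw [dslope_of_ne _ h, slope_def_field, ← neg_sub (f z) (f x), ← neg_sub z x]
    field_simp
    ring
  have hsph : ∀ x ∈ sphere (0 : ℂ) ‖z‖, x ≠ z → 0 ≤ (k x).re := by
    intro x hx h
    have hxn : ‖x‖ = ‖z‖ := by simpa using hx
    rw [hke x (sphere_subset_closedBall hx) h, Complex.sub_re]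
    have h1 : ((z + x) / (z - x)).re = 0 := by
      have : (z + x).re * (z - x).re + (z + x).im * (z - x).im = 0 := by
        have h2 := congrArg (· ^ 2) hxn
        simp only [← Complex.normSq_eq_norm_sq, Complex.normSq_apply] at h2
        simp only [Complex.add_re, Complex.sub_re, Complex.add_im, Complex.sub_im]
        linarith
      rw [Complex.div_re, ← add_div, this, zero_div]
    obtain ⟨θ, hθ, rfl⟩ := exists_mul_exp_eq hz0 hxn h
    have h2 := ConvexUnivalent.re_chord_pos hf hz hz0 hθ
    rw [h1, sub_zero, mul_assoc, mul_div_assoc, ← inv_div]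
    simp only [Complex.mul_re, Complex.inv_re, Complex.re_ofNat, Complex.im_ofNat, zero_mul,
      sub_zero]
    have := Complex.normSq_nonneg
      ((f z - f (z * Complex.exp (θ * Complex.I))) / (z * deriv f z))
    positivity
  -- At `z` itself the sign follows by continuity along the circle.
  have hkz : 0 ≤ (k z).re := by
    have hkc : ContinuousAt k z := (hkd.differentiableAt (hso.mem_nhds hzs)).continuousAt
    have hcirc : Filter.Tendsto (fun t : ℝ => z * Complex.exp (t * Complex.I))
        (nhdsWithin 0 (Ioi 0)) (nhds z) := by
      have : Continuous (fun t : ℝ => z * Complex.exp (t * Complex.I)) := by fun_prop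
      have h := this.tendsto 0
      simp only [Complex.ofReal_zero, zero_mul, Complex.exp_zero, mul_one] at h
      exact h.mono_left nhdsWithin_le_nhds
    refine ge_of_tendsto ((Complex.continuous_re.tendsto _).comp (hkc.tendsto.comp hcirc)) ?_
    filter_upwards [Ioo_mem_nhdsGT (show (0 : ℝ) < 2 * Real.pi by positivity)] with t ht
    refine hsph _ (by simp [Complex.norm_exp_ofReal_mul_I]) fun h => ?_
    have := ConvexUnivalent.re_chord_pos hf hz hz0 ht
    beta_reduce at h
    rw [h] at this
    simp at this
  have hwc : w ∈ closedBall (0 : ℂ) ‖z‖ := by simpa using hw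
  have := re_nonneg_of_re_nonneg_sphere hρ (hkd.mono hcs) (fun x hx => by
    rcases eq_or_ne x z with rfl | h
    · exact hkz
    · exact hsph x hx h) hwc
  rw [hke w hwc hne, Complex.sub_re] at this
  linarith

/-! ### The quotient of the derivative by the `q`-derivative -/

theorem ofReal_mul_mem_ball {q : ℝ} (hq0 : 0 ≤ q) (hq1 : q < 1) {z : ℂ}
    (hz : z ∈ ball (0 : ℂ) 1) : (q : ℂ) * z ∈ ball (0 : ℂ) 1 := by
  rw [mem_ball_zero_iff] at hz ⊢
  rw [norm_mul, Complex.norm_real, Real.norm_of_nonneg hq0]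
  nlinarith [norm_nonneg z]

theorem differentiableOn_jacksonDeriv {q : ℝ} (hq0 : 0 ≤ q) (hq1 : q < 1) {f : ℂ → ℂ}
    (hf : DifferentiableOn ℂ f (ball 0 1)) :
    DifferentiableOn ℂ (jacksonDeriv q f) (ball 0 1) := by
  have hq : (q : ℂ) - 1 ≠ 0 := sub_ne_zero.2 (by exact_mod_cast hq1.ne)
  have h0 : (0 : ℂ) ∈ ball (0 : ℂ) 1 := by simp
  set H : ℂ → ℂ := fun z => f (q * z) - f z with hH
  have hHd : DifferentiableOn ℂ H (ball 0 1) :=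
    (hf.comp (differentiableOn_id.const_mul (q : ℂ))
      fun z hz => ofReal_mul_mem_ball hq0 hq1 hz).sub hf
  have hJ : jacksonDeriv q f = fun z => dslope H 0 z / (q - 1) := by
    funext z
    rcases eq_or_ne z 0 with rfl | h
    · have hf0 := (hf.differentiableAt (isOpen_ball.mem_nhds h0)).hasDerivAt
      have h1 : HasDerivAt (fun z : ℂ => f (q * z)) (deriv f 0 * (q * 1)) 0 :=
        HasDerivAt.comp (0 : ℂ) (by rwa [mul_zero]) ((hasDerivAt_id (0 : ℂ)).const_mul (q : ℂ))
      have hH' : deriv H 0 = deriv f 0 * (q * 1) - deriv f 0 := (h1.sub hf0).deriv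
      rw [dslope_same, hH', jacksonDeriv, if_pos rfl]
      field_simp
    · rw [dslope_of_ne _ h, slope_def_field, jacksonDeriv, if_neg h]
      simp only [hH, mul_zero, sub_self, sub_zero]
      field_simp
  rw [hJ]
  exact ((Complex.differentiableOn_dslope (isOpen_ball.mem_nhds h0)).2 hHd).div_const _

theorem ofReal_mul_ne_self {q : ℝ} (hq1 : q < 1) {z : ℂ} (hz0 : z ≠ 0) : (q : ℂ) * z ≠ z := by
  intro h
  have h1 : (q : ℂ) = 1 := mul_right_cancel₀ hz0 (by rw [h, one_mul])
  exact hq1.ne (by exact_mod_cast h1)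

theorem ConvexUnivalent.jacksonDeriv_ne_zero {q : ℝ} (hq0 : 0 ≤ q) (hq1 : q < 1) {f : ℂ → ℂ}
    (hf : f ∈ ConvexUnivalent) {z : ℂ} (hz : z ∈ ball (0 : ℂ) 1) : jacksonDeriv q f z ≠ 0 := by
  have hq : (q : ℂ) - 1 ≠ 0 := sub_ne_zero.2 (by exact_mod_cast hq1.ne)
  unfold jacksonDeriv
  split_ifs with h
  · exact (hf.2 0 (by simp)).1
  · refine div_ne_zero (sub_ne_zero.2 ?_) (mul_ne_zero hq h)
    refine ConvexUnivalent.apply_ne hf hz h ?_ (ofReal_mul_ne_self hq1 h)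
    rw [norm_mul, Complex.norm_real, Real.norm_of_nonneg hq0]
    nlinarith [norm_nonneg z]

theorem ConvexUnivalent.le_re_deriv_div_jacksonDeriv {q : ℝ} (hq0 : 0 ≤ q) (hq1 : q < 1)
    {f : ℂ → ℂ} (hf : f ∈ ConvexUnivalent) {z : ℂ} (hz : z ∈ ball (0 : ℂ) 1) :
    (1 + q) / 2 ≤ (deriv f z / jacksonDeriv q f z).re := by
  rcases eq_or_ne z 0 with rfl | h
  · rw [jacksonDeriv, if_pos rfl, div_self (hf.2 0 hz).1, Complex.one_re]
    linarith
  have hne := ofReal_mul_ne_self hq1 h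
  have hle : ‖(q : ℂ) * z‖ ≤ ‖z‖ := by
    rw [norm_mul, Complex.norm_real, Real.norm_of_nonneg hq0]
    nlinarith [norm_nonneg z]
  have hq : (1 : ℂ) - q ≠ 0 := sub_ne_zero.2 (by exact_mod_cast hq1.ne')
  have hq' : (q : ℂ) - 1 ≠ 0 := sub_ne_zero.2 (by exact_mod_cast hq1.ne)
  have hfne := sub_ne_zero.2 (ConvexUnivalent.apply_ne hf hz h hle hne)
  have hfne' : f z - f (q * z) ≠ 0 := by rwa [← neg_ne_zero, neg_sub]
  have key := ConvexUnivalent.half_plane hf hz h hle hne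
  have h1 : (z + q * z) / (z - q * z) = (((1 + q) / (1 - q) : ℝ) : ℂ) := by
    have : z - q * z = z * (1 - q) := by ring
    rw [this]
    push_cast
    field_simp
  have h2 : 2 * z * deriv f z / (f z - f (q * z)) =
      ((2 / (1 - q) : ℝ) : ℂ) * (deriv f z / jacksonDeriv q f z) := by
    rw [jacksonDeriv, if_neg h, ← neg_sub (f z), ← neg_sub (1 : ℂ) q]
    push_cast
    field_simp
  rw [h1, h2, Complex.re_ofReal_mul, Complex.ofReal_re] at key
  have hp : 0 < 1 - q := by linarith
  rw [div_mul_eq_mul_div, div_le_div_iff_of_pos_right hp] at key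
  linarith

theorem norm_sub_one_le_norm_sub_iff {q : ℝ} {w : ℂ} {r : ℝ} (hr : 0 ≤ r) :
    ‖w - 1‖ ≤ r * ‖w - q‖ ↔
      (w.re - 1) ^ 2 + w.im ^ 2 ≤ r ^ 2 * ((w.re - q) ^ 2 + w.im ^ 2) := by
  rw [← sq_le_sq₀ (norm_nonneg _) (by positivity), mul_pow, ← Complex.normSq_eq_norm_sq,
    ← Complex.normSq_eq_norm_sq, Complex.normSq_apply, Complex.normSq_apply]
  simp [sq]

theorem ConvexUnivalent.norm_deriv_div_jacksonDeriv_sub_one_le {q : ℝ} (hq0 : 0 ≤ q) (hq1 : q < 1)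
    {f : ℂ → ℂ} (hf : f ∈ ConvexUnivalent) {z : ℂ} (hz : z ∈ ball (0 : ℂ) 1) :
    ‖deriv f z / jacksonDeriv q f z - 1‖ ≤ ‖z‖ * ‖deriv f z / jacksonDeriv q f z - q‖ := by
  set g : ℂ → ℂ := fun z => deriv f z / jacksonDeriv q f z with hg
  have hgd : DifferentiableOn ℂ g (ball 0 1) :=
    (hf.1.1.deriv isOpen_ball).div (differentiableOn_jacksonDeriv hq0 hq1 hf.1.1)
      fun x hx => ConvexUnivalent.jacksonDeriv_ne_zero hq0 hq1 hf hx
  have hre : ∀ x ∈ ball (0 : ℂ) 1, (1 + q) / 2 ≤ (g x).re := fun x hx =>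
    ConvexUnivalent.le_re_deriv_div_jacksonDeriv hq0 hq1 hf hx
  have hgq : ∀ x ∈ ball (0 : ℂ) 1, g x - q ≠ 0 := by
    intro x hx h
    have h1 := hre x hx
    rw [sub_eq_zero.1 h, Complex.ofReal_re] at h1
    linarith
  have hg0 : g 0 = 1 := by
    simp only [hg, jacksonDeriv, if_pos]
    exact div_self (hf.2 0 (by simp)).1
  have := Complex.norm_le_norm_of_mapsTo_ball (R := 1) (z := z)
    (f := fun x => (g x - 1) / (g x - q))
    ((hgd.sub_const 1).div (hgd.sub_const _) hgq) (fun x hx => ?_) (by simp [hg0]) (by simpa using hz)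
  · rwa [norm_div, div_le_iff₀ (norm_pos_iff.2 (hgq z hz))] at this
  · rw [mem_closedBall_zero_iff, norm_div, div_le_iff₀ (norm_pos_iff.2 (hgq x hx)),
      norm_sub_one_le_norm_sub_iff zero_le_one]
    nlinarith [hre x hx]

theorem bounds_of_norm_sub_one_le {q r : ℝ} (hq0 : 0 ≤ q) (hq1 : q < 1) (hr0 : 0 ≤ r) (hr1 : r < 1)
    {w : ℂ} (hw : ‖w - 1‖ ≤ r * ‖w - q‖) :
    ((1 + q * r) / (1 + r) ≤ w.re ∧ w.re ≤ (1 - q * r) / (1 - r)) ∧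
      ((1 + q * r) / (1 + r) ≤ ‖w‖ ∧ ‖w‖ ≤ (1 - q * r) / (1 - r)) := by
  rw [norm_sub_one_le_norm_sub_iff hr0] at hw
  set A := (1 + q * r) / (1 + r) with hA
  set B := (1 - q * r) / (1 - r) with hB
  have hp : 0 < 1 + r := by linarith
  have hm : 0 < 1 - r := by linarith
  have hqr : q * r ≤ r := by nlinarith
  have hA0 : 0 < A := by positivity
  have hA1 : A ≤ 1 := by rw [hA, div_le_one hp]; linarith
  have hB1 : 1 ≤ B := by rw [hB, one_le_div hm]; linarith
  -- The Apollonius disc in the form of Thales: the disc with diameter `[A, B]`.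
  have hdisc : (w.re - A) * (w.re - B) + w.im ^ 2 ≤ 0 := by
    have h : (w.re - A) * (w.re - B) + w.im ^ 2 =
        ((w.re - 1) ^ 2 + w.im ^ 2 - r ^ 2 * ((w.re - q) ^ 2 + w.im ^ 2)) /
          ((1 + r) * (1 - r)) := by
      rw [hA, hB]
      field_simp
      ring
    rw [h]
    exact div_nonpos_of_nonpos_of_nonneg (by linarith) (by positivity)
  have hprod : (w.re - A) * (w.re - B) ≤ 0 := by nlinarith [sq_nonneg w.im]
  have hlo : A ≤ w.re := by
    by_contra! h
    nlinarith [mul_pos_of_neg_of_neg (sub_neg.2 h) (show w.re - B < 0 by linarith)]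
  have hhi : w.re ≤ B := by
    by_contra! h
    nlinarith [mul_pos (show 0 < w.re - A by linarith) (sub_pos.2 h)]
  refine ⟨⟨hlo, hhi⟩, hlo.trans (Complex.re_le_norm w), ?_⟩
  rw [← sq_le_sq₀ (norm_nonneg _) (by linarith), ← Complex.normSq_eq_norm_sq, Complex.normSq_apply]
  -- `|w|² ≤ (A+B) Re w - AB ≤ (A+B)B - AB = B²`.
  nlinarith [mul_nonneg (show 0 ≤ A + B by linarith) (sub_nonneg.2 hhi)]

/-! ### Sharpness: the function `z/(1-z)` -/

theorem hasDerivAt_id_div_one_sub {w : ℂ} (hw : w ≠ 1) :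
    HasDerivAt (fun w : ℂ => w / (1 - w)) (1 / (1 - w) ^ 2) w := by
  have h : 1 - w ≠ 0 := sub_ne_zero.2 hw.symm
  refine ((hasDerivAt_id w).div ((hasDerivAt_id w).const_sub 1) h).congr_deriv ?_
  simp

theorem ne_one_of_mem_ball {w : ℂ} (hw : w ∈ ball (0 : ℂ) 1) : w ≠ 1 := by
  rintro rfl
  simp at hw

theorem deriv_deriv_id_div_one_sub {w : ℂ} (hw : w ≠ 1) :
    deriv (deriv fun w : ℂ => w / (1 - w)) w = 2 / (1 - w) ^ 3 := by
  have h : 1 - w ≠ 0 := sub_ne_zero.2 hw.symm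
  have he : (deriv fun w : ℂ => w / (1 - w)) =ᶠ[nhds w] fun w => 1 / (1 - w) ^ 2 := by
    filter_upwards [isOpen_ne.mem_nhds hw] with x hx
    exact (hasDerivAt_id_div_one_sub hx).deriv
  rw [he.deriv_eq]
  have h1 := ((hasDerivAt_const w (1 : ℂ)).div (((hasDerivAt_id w).const_sub 1).pow 2)
    (pow_ne_zero 2 h)).deriv
  refine Eq.trans h1 ?_
  simp
  field_simp

theorem id_div_one_sub_mem_convexUnivalent : (fun w : ℂ => w / (1 - w)) ∈ ConvexUnivalent := by
  refine ⟨⟨fun w hw => (hasDerivAt_id_div_one_sub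
    (ne_one_of_mem_ball hw)).differentiableAt.differentiableWithinAt, by simp, ?_⟩, fun w hw => ?_⟩
  · rw [(hasDerivAt_id_div_one_sub zero_ne_one).deriv]; simp
  · have hw1 := ne_one_of_mem_ball hw
    have h : 1 - w ≠ 0 := sub_ne_zero.2 hw1.symm
    rw [deriv_deriv_id_div_one_sub hw1, (hasDerivAt_id_div_one_sub hw1).deriv]
    refine ⟨one_div_ne_zero (pow_ne_zero 2 h), ?_⟩
    have h1 : 1 + w * (2 / (1 - w) ^ 3) / (1 / (1 - w) ^ 2) = (1 + w) / (1 - w) := by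
      field_simp
      ring
    rw [h1, Complex.div_re, ← add_div]
    refine div_pos ?_ (Complex.normSq_pos.2 h)
    have h2 : Complex.normSq w < 1 := by
      rw [Complex.normSq_eq_norm_sq]
      have := mem_ball_zero_iff.1 hw
      nlinarith [norm_nonneg w]
    rw [Complex.normSq_apply] at h2
    simp
    linarith

theorem deriv_div_jacksonDeriv_id_div_one_sub {q : ℝ} (hq0 : 0 ≤ q) (hq1 : q < 1) {x : ℝ}
    (hx : |x| < 1) :
    deriv (fun w : ℂ => w / (1 - w)) x / jacksonDeriv q (fun w : ℂ => w / (1 - w)) x =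
      (((1 - q * x) / (1 - x) : ℝ) : ℂ) := by
  have hxb : (x : ℂ) ∈ ball (0 : ℂ) 1 := by simpa using hx
  have h1 : 1 - (x : ℂ) ≠ 0 := sub_ne_zero.2 (ne_one_of_mem_ball hxb).symm
  have h2 : 1 - (q : ℂ) * x ≠ 0 :=
    sub_ne_zero.2 (ne_one_of_mem_ball (ofReal_mul_mem_ball hq0 hq1 hxb)).symm
  have hq' : (q : ℂ) - 1 ≠ 0 := sub_ne_zero.2 (by exact_mod_cast hq1.ne)
  have hJ : jacksonDeriv q (fun w : ℂ => w / (1 - w)) x = 1 / ((1 - x) * (1 - q * x)) := by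
    unfold jacksonDeriv
    split_ifs with h
    · rw [(hasDerivAt_id_div_one_sub zero_ne_one).deriv, h]; simp
    · field_simp
      ring
  rw [hJ, (hasDerivAt_id_div_one_sub (ne_one_of_mem_ball hxb)).deriv]
  push_cast
  field_simp

theorem theoremt25 (q : ℝ) (hq0 : 0 ≤ q) (hq1 : q < 1) :
    (∀ f ∈ ConvexUnivalent, ∀ (r : ℝ) (z : ℂ), ‖z‖ = r → r < 1 →
      jacksonDeriv q f z ≠ 0 ∧
      ((1 + q * r) / (1 + r) ≤ (deriv f z / jacksonDeriv q f z).re ∧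
        (deriv f z / jacksonDeriv q f z).re ≤ (1 - q * r) / (1 - r)) ∧
      ((1 + q * r) / (1 + r) ≤ ‖deriv f z / jacksonDeriv q f z‖ ∧
        ‖deriv f z / jacksonDeriv q f z‖ ≤ (1 - q * r) / (1 - r))) ∧
    ((fun w : ℂ => w / (1 - w)) ∈ ConvexUnivalent ∧
      ∀ h : ℂ → ℂ, h = (fun w : ℂ => w / (1 - w)) → ∀ r : ℝ, 0 ≤ r → r < 1 →
        (deriv h (-(r : ℂ)) / jacksonDeriv q h (-(r : ℂ))).re = (1 + q * r) / (1 + r) ∧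
        ‖deriv h (-(r : ℂ)) / jacksonDeriv q h (-(r : ℂ))‖ = (1 + q * r) / (1 + r) ∧
        (deriv h (r : ℂ) / jacksonDeriv q h (r : ℂ)).re = (1 - q * r) / (1 - r) ∧
        ‖deriv h (r : ℂ) / jacksonDeriv q h (r : ℂ)‖ = (1 - q * r) / (1 - r)) := by
  refine ⟨fun f hf r z hzr hr => ?_, id_div_one_sub_mem_convexUnivalent, ?_⟩
  · have hz : z ∈ ball (0 : ℂ) 1 := by simpa [hzr] using hr
    have hr0 : 0 ≤ r := hzr ▸ norm_nonneg z
    refine ⟨ConvexUnivalent.jacksonDeriv_ne_zero hq0 hq1 hf hz,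
      bounds_of_norm_sub_one_le hq0 hq1 hr0 hr ?_⟩
    rw [← hzr]
    exact ConvexUnivalent.norm_deriv_div_jacksonDeriv_sub_one_le hq0 hq1 hf hz
  · rintro h rfl r hr0 hr1
    have hpos := deriv_div_jacksonDeriv_id_div_one_sub hq0 hq1 (x := r)
      (by rwa [abs_of_nonneg hr0])
    have hneg := deriv_div_jacksonDeriv_id_div_one_sub hq0 hq1 (x := -r)
      (by rwa [abs_neg, abs_of_nonneg hr0])
    rw [Complex.ofReal_neg, mul_neg, sub_neg_eq_add, sub_neg_eq_add] at hneg
    have hqr : 0 ≤ 1 - q * r := by nlinarith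
    have hm : 0 ≤ 1 - r := by linarith
    rw [hpos, hneg, Complex.ofReal_re, Complex.ofReal_re, Complex.norm_real, Complex.norm_real,
      Real.norm_of_nonneg (by positivity), Real.norm_of_nonneg (by positivity)]
    exact ⟨rfl, rfl, rfl, rfl⟩
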